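/- Let $K$ be a number field with ring of integers $\mathcal{O}_K$, let $\lambda\in\mathcal{O}_K$ with $\lambda\neq 0,1$, and let $E$ be the elliptic curve $y^2=x(x+1)(x+\lambda)$ over $K$. Let $n\geq 4$ be an even integer, let $u$ be an element of an extension field of $K$ with $u^n=\lambda$, let $v$ be a square root of $\frac{u^{n-1}+1}{u+1}$ (note $u\neq -1$, since $\lambda\neq 1$ and $n$ is even), assume $v\neq 0$, and let $L=K(u,v)$. Suppose that $\mathfrak{p},\mathfrak{q}$ are nonzero prime ideals of the ring of integers $\mathcal{O}_L$, not lying over $2$ and with distinct residue characteristics, such that 1. $E$ has good reduction at $\mathfrak{p}$ and at $\mathfrak{q}$ (as a curve over $L$), 2. $v\in\mathfrak{p}\cap\mathfrak{q}$, 3. $u\notin\mathfrak{p}\cup\mathfrak{q}$ and $u+1\notin\mathfrak{p}\cup\mathfrak{q}$. Then $P=(u,\,u(u+1)v)$ is a point of $E(L)$ of infinite order. -/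

import Mathlib

open scoped NumberField WeierstrassCurve.Affine

/-- The Legendre cubic `y² = x (x + 1) (x + l)`, expanded as `y² = x³ + (1 + l) x² + l x`. It is an
elliptic curve exactly when `l ≠ 0` and `l ≠ 1`. -/
def legendreCurve {F : Type*} [Field F] (l : F) : WeierstrassCurve F :=
  ⟨0, 1 + l, 0, l, 0⟩

theorem legendreCurve_equation_iff {F : Type*} [Field F] (l x y : F) :
    (legendreCurve l).toAffine.Equation x y ↔ y ^ 2 = x * (x + 1) * (x + l) := by
  rw [WeierstrassCurve.Affine.equation_iff]
  simp only [legendreCurve]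
  constructor <;> intro h <;> linear_combination h

theorem legendreCurve_isElliptic_iff {F : Type*} [Field F] (h2 : (2 : F) ≠ 0) (l : F) :
    (legendreCurve l).IsElliptic ↔ l ≠ 0 ∧ l ≠ 1 := by
  have h : (legendreCurve l).Δ = 2 ^ 4 * (l ^ 2 * (l - 1) ^ 2) := by
    simp only [legendreCurve, WeierstrassCurve.Δ, WeierstrassCurve.b₂, WeierstrassCurve.b₄,
      WeierstrassCurve.b₆, WeierstrassCurve.b₈]
    ring
  rw [WeierstrassCurve.isElliptic_iff, isUnit_iff_ne_zero, h]
  simp [h2, sub_eq_zero]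

/-- A Weierstrass curve over a number field `L` has good reduction at a nonzero prime `𝔭` of `𝓞 L`
if a minimal Weierstrass equation of it over the discrete valuation ring
`{x ∈ L | x is 𝔭-integral}` has good reduction. -/
def HasGoodReductionAt {L : Type*} [Field L] [NumberField L] (W : WeierstrassCurve L)
    (𝔭 : IsDedekindDomain.HeightOneSpectrum (𝓞 L)) : Prop :=
  (W.minimal (𝔭.valuation L).integer).HasGoodReduction (𝔭.valuation L).integer

/-! The relation `(u + 1) v² = u ^ (n - 1) + 1` gives `u + λ = u (u + 1) v²`. Hence `P` lies on the
curve, and modulo `𝔭` it becomes `(u, 0)`, where the cubic has derivative `u (u + 1)`, a unit. The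
tangent at `P` is therefore vertical modulo `𝔭`, and `2P` lies in the kernel of reduction
(`inReductionKernel_two_nsmul`).

Torsion in that kernel has order a power of the residue characteristic
(`InReductionKernel.addOrderOf_eq_prime_pow`). Were `P` torsion, the order of `2P` would divide
powers of two distinct primes, so `2P = 0`, which `y(P) ≠ 0` forbids.

The torsion statement rests on `NearInfinity.add`: `t = x / y` is additive up to third order.
Explicit estimates on chords `s = α t + β`, with `s = 1 / y`, play the role of the formal group; the
algebra behind them is `legendreCurve_third_point`. -/

open WeierstrassCurve WeierstrassCurve.Affine

/-! ### Chords and tangents in the coordinates at infinity. -/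

section Chord

variable {F : Type*} [Field F]

theorem legendreCurve_negY (l x y : F) : (legendreCurve l).toAffine.negY x y = -y := by
  simp [legendreCurve, negY]

variable [DecidableEq F]

/-- The elementary symmetric functions of the abscissas of three collinear points. -/
theorem legendreCurve_vieta {l x₁ y₁ x₂ y₂ : F}
    (h₁ : (legendreCurve l).toAffine.Equation x₁ y₁)
    (h₂ : (legendreCurve l).toAffine.Equation x₂ y₂)
    (hxy : ¬(x₁ = x₂ ∧ y₁ = (legendreCurve l).toAffine.negY x₂ y₂))
    {m c x₃ : F} (hm : m = (legendreCurve l).toAffine.slope x₁ x₂ y₁ y₂)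
    (hc : c = y₁ - m * x₁) (hx₃ : x₃ = (legendreCurve l).toAffine.addX x₁ x₂ m) :
    x₁ + x₂ + x₃ = m ^ 2 - (1 + l) ∧ x₁ * x₂ + x₁ * x₃ + x₂ * x₃ = l - 2 * m * c ∧
      x₁ * x₂ * x₃ = c ^ 2 := by
  have key := addPolynomial_slope h₁ h₂ hxy
  rw [← hm, ← hx₃, addPolynomial_eq, neg_inj] at key
  -- The value at 0 gives the product of the roots; the value at 1, combined with their sum, gives
  -- the second symmetric function.
  have e0 := congrArg (Polynomial.eval 0) key
  have e1 := congrArg (Polynomial.eval 1) key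
  simp only [Cubic.toPoly, legendreCurve, Polynomial.eval_add, Polynomial.eval_mul,
    Polynomial.eval_pow, Polynomial.eval_X, Polynomial.eval_C, Polynomial.eval_sub] at e0 e1
  have e2 : x₁ + x₂ + x₃ = m ^ 2 - (1 + l) := by
    rw [hx₃]; simp only [legendreCurve, addX]; ring
  subst hc
  refine ⟨e2, ?_, ?_⟩
  · linear_combination e0 - e1 + e2
  · linear_combination e0

/-- In the coordinates `t = x / y`, `s = 1 / y`, the slope of the chord (or tangent) through two
points is a quotient whose denominator does not vanish near the origin. -/
theorem legendreCurve_slope_mul {l x₁ y₁ x₂ y₂ : F}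
    (h₁ : (legendreCurve l).toAffine.Equation x₁ y₁)
    (h₂ : (legendreCurve l).toAffine.Equation x₂ y₂)
    (hxy : ¬(x₁ = x₂ ∧ y₁ = (legendreCurve l).toAffine.negY x₂ y₂))
    {m c t₁ s₁ t₂ s₂ U V : F} (hm : m = (legendreCurve l).toAffine.slope x₁ x₂ y₁ y₂)
    (hc : c = y₁ - m * x₁) (hs₁ : s₁ * y₁ = 1) (hs₂ : s₂ * y₂ = 1)
    (ht₁ : t₁ = x₁ * s₁) (ht₂ : t₂ = x₂ * s₂)
    (hU : U = 1 - (1 + l) * t₂ ^ 2 - l * t₂ * (s₁ + s₂))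
    (hV : V = t₁ ^ 2 + t₁ * t₂ + t₂ ^ 2 + (1 + l) * s₁ * (t₁ + t₂) + l * s₁ ^ 2)
    (hU0 : U ≠ 0) : m * U = -(c * V) := by
  have hs₁0 : s₁ ≠ 0 := left_ne_zero_of_mul_eq_one hs₁
  have hs₂0 : s₂ ≠ 0 := left_ne_zero_of_mul_eq_one hs₂
  have hx₁ : x₁ = t₁ * y₁ := by rw [ht₁]; linear_combination (-x₁) * hs₁
  have hx₂ : x₂ = t₂ * y₂ := by rw [ht₂]; linear_combination (-x₂) * hs₂
  have curve {x y t s : F} (h : y ^ 2 = x * (x + 1) * (x + l)) (hs : s * y = 1) (ht : t = x * s) :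
      s = t ^ 3 + (1 + l) * t ^ 2 * s + l * t * s ^ 2 := by
    rw [ht]
    linear_combination s ^ 3 * h + (-(s * (s * y + 1))) * hs
  have k₁ := curve ((legendreCurve_equation_iff l _ _).mp h₁) hs₁ ht₁
  have k₂ := curve ((legendreCurve_equation_iff l _ _).mp h₂) hs₂ ht₂
  by_cases hx : x₁ = x₂
  · have hy : y₁ = y₂ := Y_eq_of_Y_ne h₁ h₂ hx fun h => hxy ⟨hx, h⟩
    rw [legendreCurve_negY] at hxy
    subst hx hy
    have hss : s₂ = s₁ := mul_right_cancel₀ (right_ne_zero_of_mul_eq_one hs₁) (hs₂.trans hs₁.symm)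
    subst hss
    have htt : t₂ = t₁ := ht₂.trans ht₁.symm
    subst htt
    have hne : y₁ ≠ (legendreCurve l).toAffine.negY x₁ y₁ := by
      rw [legendreCurve_negY]; exact fun h => hxy ⟨rfl, h⟩
    rw [slope_of_Y_ne rfl hne, eq_div_iff (sub_ne_zero.mpr hne), legendreCurve_negY] at hm
    simp only [legendreCurve] at hm
    have a1 : 2 * m * s₂ = V := by
      rw [hV, ht₁]
      linear_combination s₂ ^ 2 * hm - 2 * m * s₂ * hs₁
    have a2 : c * s₂ = 1 - m * t₂ := by rw [hc, ht₁]; linear_combination hs₁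
    -- Euler's relation for the homogenized cubic in `(t, s)`, whose partial derivatives are `-V`,
    -- `U` and `2 s`.
    have a3 : s₂ * (U + 2 - 2 * m * t₂) = 0 := by
      rw [hU]
      linear_combination (-t₂) * a1 - t₂ * hV + 3 * k₁
    have a4 := (mul_eq_zero.mp a3).resolve_left hs₂0
    linear_combination m * a4 - c * a1 + 2 * m * a2
  · rw [slope_of_X_ne hx, eq_div_iff (sub_ne_zero.mpr hx)] at hm
    have a1 : c * s₁ = 1 - m * t₁ := by rw [hc, ht₁]; linear_combination hs₁
    have a2 : c * s₂ = 1 - m * t₂ := by rw [hc, ht₂]; linear_combination hs₂ - s₂ * hm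
    -- The difference of the two curve equations factors through `t₂ - t₁` and `s₂ - s₁`. As the
    -- line reads `1 = m t + c s`, its slope in these coordinates is `-m / c = V / U`.
    have a3 : U * (s₂ - s₁) = V * (t₂ - t₁) := by
      rw [hU, hV]; linear_combination k₂ - k₁
    have htne : t₂ - t₁ ≠ 0 := by
      intro h
      rw [h, mul_zero] at a3
      have hs := sub_eq_zero.mp ((mul_eq_zero.mp a3).resolve_left hU0)
      apply hx
      have hy : y₁ = y₂ := mul_left_cancel₀ hs₁0 (by rw [hs₁, ← hs, hs₂])
      rw [hx₁, hx₂, hy, sub_eq_zero.mp h]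
    apply mul_left_cancel₀ htne
    linear_combination (-c) * a3 + U * (a2 - a1)

/-- The chord through two points, as a line `s = α t + β` in the coordinates
`t = x / y`, `s = 1 / y`, and its third intersection point with the curve. -/
theorem legendreCurve_third_point {l x₁ y₁ x₂ y₂ : F}
    (h₁ : (legendreCurve l).toAffine.Equation x₁ y₁)
    (h₂ : (legendreCurve l).toAffine.Equation x₂ y₂)
    (hxy : ¬(x₁ = x₂ ∧ y₁ = (legendreCurve l).toAffine.negY x₂ y₂))
    {t₁ s₁ t₂ s₂ x₃ y₃ α : F} (hs₁ : s₁ * y₁ = 1) (hs₂ : s₂ * y₂ = 1)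
    (ht₁ : t₁ = x₁ * s₁) (ht₂ : t₂ = x₂ * s₂)
    (hx₃ : x₃ = (legendreCurve l).toAffine.addX x₁ x₂
      ((legendreCurve l).toAffine.slope x₁ x₂ y₁ y₂))
    (hy₃ : y₃ = (legendreCurve l).toAffine.negAddY x₁ x₂ y₁
      ((legendreCurve l).toAffine.slope x₁ x₂ y₁ y₂))
    (hU0 : 1 - (1 + l) * t₂ ^ 2 - l * t₂ * (s₁ + s₂) ≠ 0)
    (hα : α * (1 - (1 + l) * t₂ ^ 2 - l * t₂ * (s₁ + s₂)) =
      t₁ ^ 2 + t₁ * t₂ + t₂ ^ 2 + (1 + l) * s₁ * (t₁ + t₂) + l * s₁ ^ 2)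
    (hD : 1 + (1 + l) * α + l * α ^ 2 ≠ 0) :
    y₃ ≠ 0 ∧ y₃⁻¹ = α * (x₃ / y₃) + (s₁ - α * t₁) ∧
      (1 + (1 + l) * α + l * α ^ 2) * (t₁ + t₂ + x₃ / y₃) =
        -((1 + l + 2 * l * α) * (s₁ - α * t₁)) := by
  set m := (legendreCurve l).toAffine.slope x₁ x₂ y₁ y₂ with hm
  set c := y₁ - m * x₁ with hc
  have key := legendreCurve_slope_mul h₁ h₂ hxy hm hc hs₁ hs₂ ht₁ ht₂ rfl rfl hU0
  obtain ⟨e1, e2, e3⟩ := legendreCurve_vieta h₁ h₂ hxy hm hc hx₃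
  rw [← hα] at key
  have hmα : m = -(c * α) := mul_right_cancel₀ hU0 (by linear_combination key)
  have hline : c * (s₁ - α * t₁) = 1 := by
    rw [ht₁]; linear_combination hs₁ + s₁ * hc - x₁ * s₁ * hmα
  have hc0 : c ≠ 0 := left_ne_zero_of_mul_eq_one hline
  set β := s₁ - α * t₁ with hβ
  have hy1 : y₁ = m * x₁ + c := by rw [hc]; ring
  have hy2 : y₂ = m * x₂ + c := by
    by_cases hx : x₁ = x₂
    · rw [← hx, ← hy1, Y_eq_of_Y_ne h₁ h₂ hx fun h => hxy ⟨hx, h⟩]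
    · rw [slope_of_X_ne hx, eq_div_iff (sub_ne_zero.mpr hx)] at hm
      rw [hc]; linear_combination hm
  have hy3 : y₃ = m * x₃ + c := by
    rw [hy₃, negAddY, ← hx₃, hc]; ring
  -- Substituting `s = α t + β` in the curve gives a cubic in `t` with leading coefficient `1 + (1 +
  -- l) α + l α²`. The claimed sum of the `t`'s is Vieta for that cubic, obtained here by clearing
  -- the denominators `y₁ y₂ y₃`.
  have hprod : y₁ * y₂ * y₃ = c ^ 3 * (1 + (1 + l) * α + l * α ^ 2) := by
    rw [hy1, hy2, hy3]
    have : (m * x₁ + c) * (m * x₂ + c) * (m * x₃ + c) =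
        c ^ 3 - (1 + l) * m * c ^ 2 + l * m ^ 2 * c := by
      linear_combination m ^ 3 * e3 + m ^ 2 * c * e2 + m * c ^ 2 * e1
    rw [this, hmα]; ring
  have hy30 : y₃ ≠ 0 := by
    intro h
    rw [h, mul_zero] at hprod
    exact mul_ne_zero (pow_ne_zero 3 hc0) hD hprod.symm
  have hs₃ : y₃⁻¹ * y₃ = 1 := inv_mul_cancel₀ hy30
  refine ⟨hy30, ?_, ?_⟩
  · apply mul_right_cancel₀ hy30
    apply mul_left_cancel₀ hc0
    rw [add_mul, mul_assoc, div_mul_cancel₀ _ hy30, hs₃]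
    linear_combination -hy3 - y₃ * hline - x₃ * hmα
  · have hy10 : y₁ ≠ 0 := right_ne_zero_of_mul_eq_one hs₁
    have hy20 : y₂ ≠ 0 := right_ne_zero_of_mul_eq_one hs₂
    apply mul_left_cancel₀ (pow_ne_zero 3 hc0)
    rw [← mul_assoc, ← hprod]
    have f1 : y₁ * y₂ * y₃ * (t₁ + t₂ + x₃ / y₃) = x₁ * y₂ * y₃ + y₁ * x₂ * y₃ + y₁ * y₂ * x₃ := by
      rw [ht₁, ht₂, div_eq_mul_inv]
      linear_combination x₁ * y₂ * y₃ * hs₁ + y₁ * x₂ * y₃ * hs₂ + y₁ * y₂ * x₃ * hs₃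
    have f2 : x₁ * y₂ * y₃ + y₁ * x₂ * y₃ + y₁ * y₂ * x₃ = 2 * l * m * c - (1 + l) * c ^ 2 := by
      rw [hy1, hy2, hy3]
      linear_combination 3 * m ^ 2 * e3 + 2 * m * c * e2 + c ^ 2 * e1
    rw [f1, f2]
    linear_combination 2 * l * c * hmα + (1 + l + 2 * l * α) * c ^ 2 * hline

end Chord

/-! ### The filtration near infinity and torsion in the kernel of reduction. -/

section Filtration

variable {F : Type*} [Field F]

/-- The local parameter `x / y` at the point at infinity. -/
def tCoord {W : WeierstrassCurve F} : W.toAffine.Point → F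
  | .zero => 0
  | .some x y _ => x / y

/-- The function `1 / y`, which vanishes at the point at infinity. -/
def sCoord {W : WeierstrassCurve F} : W.toAffine.Point → F
  | .zero => 0
  | .some _ y _ => y⁻¹

variable {Γ : Type*} [LinearOrderedCommGroupWithZero Γ] (v : Valuation F Γ)

/-- The points within distance `ρ` of the point at infinity. -/
structure NearInfinity {W : WeierstrassCurve F} (ρ : Γ) (P : W.toAffine.Point) : Prop where
  t_le : v (tCoord P) ≤ ρ
  s_le : v (sCoord P) ≤ ρ ^ 3
  -- Since `0⁻¹ = 0`, the affine points with `y = 0` also have `t = s = 0`; this field excludes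
  -- them.
  eq_zero : sCoord P = 0 → P = 0

variable {v}

theorem NearInfinity.zero {W : WeierstrassCurve F} (ρ : Γ) :
    NearInfinity v ρ (0 : W.toAffine.Point) where
  t_le := by change v 0 ≤ ρ; simp
  s_le := by change v 0 ≤ ρ ^ 3; simp
  eq_zero _ := rfl

theorem Valuation.map_mul_le_of_le_one {a b : F} {g : Γ} (ha : v a ≤ 1) (hb : v b ≤ g) :
    v (a * b) ≤ g := by
  rw [map_mul]; exact (mul_le_mul' ha hb).trans_eq (one_mul g)

theorem Valuation.map_mul_le_mul {a b : F} {g h : Γ} (ha : v a ≤ g) (hb : v b ≤ h) :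
    v (a * b) ≤ g * h := by
  rw [map_mul]; exact mul_le_mul' ha hb

variable (v) in
/-- The kernel of reduction: the points whose abscissa is not integral, and the point at
infinity. -/
def InReductionKernel {W : WeierstrassCurve F} : W.toAffine.Point → Prop
  | .zero => True
  | .some x _ _ => 1 < v x

/-- When `x` is not integral, `x`, `x + 1` and `x + l` have equal valuation, so `v y ^ 2 = v x ^ 3`;
thus `t` has valuation below 1 and `1 / y` has exactly that of `t ^ 3`. -/
theorem InReductionKernel.nearInfinity {l : F} (hl : v l ≤ 1)
    {P : (legendreCurve l).toAffine.Point} (hP : InReductionKernel v P) (hP0 : P ≠ 0) :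
    tCoord P ≠ 0 ∧ v (tCoord P) < 1 ∧ NearInfinity v (v (tCoord P)) P := by
  rcases P with _ | ⟨x, y, h⟩
  · exact absurd rfl hP0
  have hx : 1 < v x := hP
  have hx0 : x ≠ 0 := by rintro rfl; simp at hx
  have heq := (legendreCurve_equation_iff l x y).mp h.1
  have hvx {a : F} (ha : v a ≤ 1) : v (x + a) = v x :=
    v.map_add_eq_of_lt_left (ha.trans_lt hx)
  have hv : v y ^ 2 = v x ^ 3 := by
    rw [← map_pow, heq, map_mul, map_mul, hvx (map_one v).le, hvx hl, pow_succ, sq]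
  have hy0 : y ≠ 0 := by
    rintro rfl
    rw [map_zero, zero_pow two_ne_zero] at hv
    exact pow_ne_zero 3 ((v.ne_zero_iff).mpr hx0) hv.symm
  have vx0 : v x ≠ 0 := (v.ne_zero_iff).mpr hx0
  have vy0 : v y ≠ 0 := (v.ne_zero_iff).mpr hy0
  have ht : v (x / y) ^ 2 = (v x)⁻¹ := by
    rw [map_div₀, div_pow, hv]; field_simp
  have hs : v y⁻¹ = v (x / y) ^ 3 := by
    rw [map_inv₀, map_div₀, div_pow, ← hv]; field_simp
  refine ⟨div_ne_zero hx0 hy0, ?_, le_rfl, hs.le, fun h0 => absurd h0 (inv_ne_zero hy0)⟩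
  by_contra! hlt
  have h1 : (1 : Γ) ≤ v (x / y) ^ 2 := one_le_pow₀ hlt
  rw [ht] at h1
  exact absurd h1 (not_le.mpr (inv_lt_one_of_one_lt₀ hx))

/-- If `x` were integral, so would be `y` by the equation, whereas `1 / y` has valuation below 1. -/
theorem NearInfinity.inReductionKernel {l : F} (hl : v l ≤ 1) {ρ : Γ} (hρ : ρ < 1)
    {P : (legendreCurve l).toAffine.Point} (hP : NearInfinity v ρ P) : InReductionKernel v P := by
  rcases P with _ | ⟨x, y, h⟩
  · trivial
  change 1 < v x
  have hy0 : y ≠ 0 := fun hy => Point.some_ne_zero h (hP.eq_zero (by simp [sCoord, hy]))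
  have hs : v y⁻¹ < 1 := hP.s_le.trans_lt (pow_lt_one₀ zero_le hρ three_ne_zero)
  by_contra! hx
  have heq := (legendreCurve_equation_iff l x y).mp h.1
  have hy : v y ^ 2 ≤ 1 := by
    rw [← map_pow, heq, map_mul, map_mul]
    exact mul_le_one' (mul_le_one' hx (v.map_add_le hx (map_one v).le)) (v.map_add_le hx hl)
  have h1 : v y⁻¹ ^ 2 < 1 := pow_lt_one₀ zero_le hs two_ne_zero
  have h2 : v y ^ 2 * v y⁻¹ ^ 2 = 1 := by
    rw [← mul_pow, ← map_mul, mul_inv_cancel₀ hy0, map_one, one_pow]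
  exact absurd h2 (((mul_le_mul' hy le_rfl).trans_eq (one_mul _)).trans_lt h1).ne

variable [DecidableEq F]

/-- Near the point at infinity, the local parameter is additive up to terms of order three. -/
theorem NearInfinity.add {l : F} (hl : v l ≤ 1) {ρ : Γ} (hρ : ρ < 1)
    {P Q : (legendreCurve l).toAffine.Point} (hP : NearInfinity v ρ P) (hQ : NearInfinity v ρ Q) :
    NearInfinity v ρ (P + Q) ∧ v (tCoord (P + Q) - (tCoord P + tCoord Q)) ≤ ρ ^ 3 := by
  have hρ1 : ρ ≤ 1 := hρ.le
  have hpow {i j : ℕ} (h : j ≤ i) : ρ ^ i ≤ ρ ^ j := pow_le_pow_right_of_le_one' hρ1 h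
  have t0 : tCoord (0 : (legendreCurve l).toAffine.Point) = 0 := rfl
  rcases P with _ | ⟨x₁, y₁, h₁⟩
  · rw [← Point.zero_def]
    rw [zero_add, t0, zero_add, sub_self, map_zero]
    exact ⟨hQ, zero_le⟩
  rcases Q with _ | ⟨x₂, y₂, h₂⟩
  · rw [← Point.zero_def]
    rw [add_zero, t0, add_zero, sub_self, map_zero]
    exact ⟨hP, zero_le⟩
  have ne_zero {x y : F} {h : (legendreCurve l).toAffine.Nonsingular x y}
      (hN : NearInfinity v ρ (Point.some x y h)) : y ≠ 0 := fun hy =>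
    Point.some_ne_zero h (hN.eq_zero (by simp [sCoord, hy]))
  have hy₁ := ne_zero hP
  have hy₂ := ne_zero hQ
  by_cases hxy : x₁ = x₂ ∧ y₁ = (legendreCurve l).toAffine.negY x₂ y₂
  · rw [Point.add_of_Y_eq hxy.1 hxy.2]
    refine ⟨.zero ρ, ?_⟩
    have : tCoord (Point.some x₁ y₁ h₁) + tCoord (Point.some x₂ y₂ h₂) = 0 := by
      have h := hxy.2
      rw [legendreCurve_negY] at h
      simp only [tCoord, hxy.1, h, div_neg, neg_add_cancel]
    rw [this, t0, sub_self, map_zero]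
    exact zero_le
  rw [Point.add_some hxy]
  set x₃ := (legendreCurve l).toAffine.addX x₁ x₂
      ((legendreCurve l).toAffine.slope x₁ x₂ y₁ y₂) with hx₃
  set y₃ := (legendreCurve l).toAffine.negAddY x₁ x₂ y₁
      ((legendreCurve l).toAffine.slope x₁ x₂ y₁ y₂) with hy₃
  -- The sum is the reflection of the third intersection point, so its `t` is `-x₃ / y₃`; the
  -- additivity error is then minus the sum of the three collinear `t`'s.
  have hadd : (legendreCurve l).toAffine.addY x₁ x₂ y₁
      ((legendreCurve l).toAffine.slope x₁ x₂ y₁ y₂) = -y₃ := by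
    rw [addY, legendreCurve_negY]
  obtain ⟨t₁, ht₁⟩ : ∃ t₁, t₁ = tCoord (Point.some x₁ y₁ h₁) := ⟨_, rfl⟩
  obtain ⟨t₂, ht₂⟩ : ∃ t₂, t₂ = tCoord (Point.some x₂ y₂ h₂) := ⟨_, rfl⟩
  obtain ⟨s₁, hs₁⟩ : ∃ s₁, s₁ = sCoord (Point.some x₁ y₁ h₁) := ⟨_, rfl⟩
  obtain ⟨s₂, hs₂⟩ : ∃ s₂, s₂ = sCoord (Point.some x₂ y₂ h₂) := ⟨_, rfl⟩
  have vt₁ := hP.t_le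
  have vt₂ := hQ.t_le
  have vs₁ := hP.s_le
  have vs₂ := hQ.s_le
  rw [← ht₁] at vt₁ ⊢
  rw [← ht₂] at vt₂ ⊢
  rw [← hs₁] at vs₁
  rw [← hs₂] at vs₂
  have hl1 : v (1 + l) ≤ 1 := v.map_add_le (map_one v).le hl
  have vt12 : v (t₁ + t₂) ≤ ρ := v.map_add_le vt₁ vt₂
  have hsq {a b : F} (ha : v a ≤ ρ) (hb : v b ≤ ρ) : v (a * b) ≤ ρ ^ 2 := by
    rw [sq]; exact Valuation.map_mul_le_mul ha hb
  have vs₁' : v s₁ ≤ ρ := vs₁.trans ((hpow (by norm_num)).trans_eq (pow_one ρ))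
  have vs₂' : v s₂ ≤ ρ := vs₂.trans ((hpow (by norm_num)).trans_eq (pow_one ρ))
  have hρ2 : ρ ^ 2 < 1 := pow_lt_one₀ zero_le hρ two_ne_zero
  obtain ⟨U, hU⟩ : ∃ U, U = 1 - (1 + l) * t₂ ^ 2 - l * t₂ * (s₁ + s₂) := ⟨_, rfl⟩
  obtain ⟨V, hV⟩ : ∃ V, V =
    t₁ ^ 2 + t₁ * t₂ + t₂ ^ 2 + (1 + l) * s₁ * (t₁ + t₂) + l * s₁ ^ 2 := ⟨_, rfl⟩
  -- `U` and `D` are 1 plus terms of valuation at most `ρ ^ 2`, hence units. So `α = V / U` is of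
  -- order two, `β = s₁ - α t₁` of order three, and the sum of the `t`'s is an integral multiple of
  -- `β`.
  have vU : v U = 1 := by
    have e : U = 1 - ((1 + l) * (t₂ * t₂) + l * (t₂ * (s₁ + s₂))) := by rw [hU]; ring
    rw [e]
    refine v.map_one_sub_of_lt (lt_of_le_of_lt (v.map_add_le ?_ ?_) hρ2)
    · exact Valuation.map_mul_le_of_le_one hl1 (hsq vt₂ vt₂)
    · exact Valuation.map_mul_le_of_le_one hl (hsq vt₂ (v.map_add_le vs₁' vs₂'))
  have vV : v V ≤ ρ ^ 2 := by
    have e : V = t₁ * t₁ + t₁ * t₂ + t₂ * t₂ + (1 + l) * (s₁ * (t₁ + t₂)) + l * (s₁ * s₁) := by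
      rw [hV]; ring
    rw [e]
    exact v.map_add_le (v.map_add_le (v.map_add_le (v.map_add_le (hsq vt₁ vt₁) (hsq vt₁ vt₂))
      (hsq vt₂ vt₂)) (Valuation.map_mul_le_of_le_one hl1 (hsq vs₁' vt12)))
      (Valuation.map_mul_le_of_le_one hl (hsq vs₁' vs₁'))
  have hU0 : U ≠ 0 := by
    rintro h; rw [h, map_zero] at vU; exact zero_ne_one vU
  obtain ⟨α, hα⟩ : ∃ α, α * U = V := ⟨V / U, div_mul_cancel₀ V hU0⟩
  have vα : v α ≤ ρ ^ 2 := by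
    rw [← hα, map_mul, vU, mul_one] at vV; exact vV
  have vα1 : v α ≤ 1 := vα.trans hρ2.le
  obtain ⟨D, hD⟩ : ∃ D, D = 1 + (1 + l) * α + l * α ^ 2 := ⟨_, rfl⟩
  have vD : v D = 1 := by
    have e : D = 1 + ((1 + l) * α + l * (α * α)) := by rw [hD]; ring
    rw [e]
    refine v.map_one_add_of_lt (lt_of_le_of_lt (v.map_add_le ?_ ?_) hρ2)
    · exact Valuation.map_mul_le_of_le_one hl1 vα
    · exact Valuation.map_mul_le_of_le_one hl (Valuation.map_mul_le_of_le_one vα1 vα)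
  have hD0 : D ≠ 0 := by
    rintro h; rw [h, map_zero] at vD; exact zero_ne_one vD
  obtain ⟨hy₃0, e₁, e₂⟩ := legendreCurve_third_point h₁.1 h₂.1 hxy (t₁ := t₁) (t₂ := t₂)
    (s₁ := s₁) (s₂ := s₂) (α := α) (by rw [hs₁, sCoord, inv_mul_cancel₀ hy₁])
    (by rw [hs₂, sCoord, inv_mul_cancel₀ hy₂]) (by rw [ht₁, hs₁, tCoord, sCoord, div_eq_mul_inv])
    (by rw [ht₂, hs₂, tCoord, sCoord, div_eq_mul_inv]) hx₃ hy₃ (hU ▸ hU0) (by rw [← hU, hα, hV])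
    (hD ▸ hD0)
  rw [← hD] at e₂
  have hα3 {a : F} (ha : v a ≤ ρ) : v (α * a) ≤ ρ ^ 3 :=
    (Valuation.map_mul_le_mul vα ha).trans_eq (pow_succ ρ 2).symm
  have vβ : v (s₁ - α * t₁) ≤ ρ ^ 3 := v.map_sub_le vs₁ (hα3 vt₁)
  have vsum : v (t₁ + t₂ + x₃ / y₃) ≤ ρ ^ 3 := by
    have h := congrArg v e₂
    rw [map_mul, vD, one_mul, Valuation.map_neg] at h
    rw [h]
    refine Valuation.map_mul_le_of_le_one (v.map_add_le hl1 ?_) vβ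
    have e : 2 * l * α = (l + l) * α := by ring
    rw [e]
    exact Valuation.map_mul_le_of_le_one (v.map_add_le hl hl) vα1
  have vt₃ : v (x₃ / y₃) ≤ ρ := by
    have e : x₃ / y₃ = (t₁ + t₂ + x₃ / y₃) - (t₁ + t₂) := by ring
    rw [e]
    exact v.map_sub_le (vsum.trans ((hpow (by norm_num)).trans_eq (pow_one ρ))) vt12
  refine ⟨⟨?_, ?_, ?_⟩, ?_⟩
  · simp only [tCoord, hadd]
    rw [div_neg, Valuation.map_neg]
    exact vt₃
  · simp only [sCoord, hadd]
    rw [inv_neg, Valuation.map_neg, e₁]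
    exact v.map_add_le (hα3 vt₃) vβ
  · simp only [sCoord, hadd]
    intro h
    exact absurd h (inv_ne_zero (neg_ne_zero.mpr hy₃0))
  · simp only [tCoord, hadd]
    have e : x₃ / -y₃ - (t₁ + t₂) = -(t₁ + t₂ + x₃ / y₃) := by rw [div_neg]; ring
    rw [e, Valuation.map_neg]
    exact vsum

/-- By the ultrametric inequality the errors of successive additions do not accumulate. -/
theorem NearInfinity.nsmul {l : F} (hl : v l ≤ 1) {ρ : Γ} (hρ : ρ < 1)
    {P : (legendreCurve l).toAffine.Point} (hP : NearInfinity v ρ P) (m : ℕ) :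
    NearInfinity v ρ (m • P) ∧ v (tCoord (m • P) - m * tCoord P) ≤ ρ ^ 3 := by
  induction m with
  | zero =>
    have t0 : tCoord (0 : (legendreCurve l).toAffine.Point) = 0 := rfl
    rw [zero_nsmul, t0, Nat.cast_zero, zero_mul, sub_self, map_zero]
    exact ⟨.zero ρ, zero_le⟩
  | succ m ih =>
    obtain ⟨h₁, h₂⟩ := ih.1.add hl hρ hP
    rw [succ_nsmul]
    refine ⟨h₁, ?_⟩
    have e : tCoord (m • P + P) - ((m + 1 : ℕ) : F) * tCoord P =
        (tCoord (m • P + P) - (tCoord (m • P) + tCoord P)) +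
          (tCoord (m • P) - m * tCoord P) := by push_cast; ring
    rw [e]
    exact v.map_add_le h₂ ih.2

theorem InReductionKernel.nsmul {l : F} (hl : v l ≤ 1)
    {P : (legendreCurve l).toAffine.Point} (hP : InReductionKernel v P) (m : ℕ) :
    InReductionKernel v (m • P) := by
  by_cases hP0 : P = 0
  · rw [hP0, nsmul_zero]; trivial
  obtain ⟨_, h1, h⟩ := hP.nearInfinity hl hP0
  exact (h.nsmul hl h1 m).1.inReductionKernel hl h1

/-- The kernel of reduction has no torsion of order prime to the residue characteristic. -/
theorem InReductionKernel.eq_zero_of_nsmul_eq_zero {l : F} (hl : v l ≤ 1)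
    {P : (legendreCurve l).toAffine.Point} (hP : InReductionKernel v P) {m : ℕ}
    (hm : v (m : F) = 1) (h : m • P = 0) : P = 0 := by
  by_contra hP0
  obtain ⟨ht0, h1, hN⟩ := hP.nearInfinity hl hP0
  have h2 := (hN.nsmul hl h1 m).2
  have t0 : tCoord (0 : (legendreCurve l).toAffine.Point) = 0 := rfl
  -- As `m` is a unit, `v t ≤ v t ^ 3` follows, which `0 < v t < 1` excludes.
  rw [h, t0, zero_sub, Valuation.map_neg, map_mul, hm, one_mul] at h2
  have hpos : 0 < v (tCoord P) := (v.pos_iff).mpr ht0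
  have h3 : v (tCoord P) ^ 2 < 1 := pow_lt_one₀ zero_le h1 two_ne_zero
  have h4 : v (tCoord P) ^ 3 < v (tCoord P) := by
    rw [pow_succ]
    exact (mul_lt_mul_of_pos_right h3 hpos).trans_eq (one_mul _)
  exact absurd h2 (not_le.mpr h4)

/-- A torsion point in the kernel of reduction has order a power of the residue
characteristic. -/
theorem InReductionKernel.addOrderOf_eq_prime_pow {l : F} (hl : v l ≤ 1)
    {P : (legendreCurve l).toAffine.Point} (hP : InReductionKernel v P)
    (hfin : IsOfFinAddOrder P) {p : ℕ} (hp : p.Prime)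
    (hv : ∀ m : ℕ, ¬ p ∣ m → v (m : F) = 1) : ∃ k, addOrderOf P ∣ p ^ k := by
  obtain ⟨k, m, hpm, hk⟩ :=
    Nat.exists_eq_pow_mul_and_not_dvd hfin.addOrderOf_pos.ne' p hp.ne_one
  refine ⟨k, addOrderOf_dvd_of_nsmul_eq_zero ?_⟩
  refine (hP.nsmul hl (p ^ k)).eq_zero_of_nsmul_eq_zero hl (hv m hpm) ?_
  rw [← mul_nsmul, ← hk, addOrderOf_nsmul_eq_zero]

end Filtration

/-! ### Doubling a point that reduces to 2-torsion. -/

section Doubling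

variable {F : Type*} [Field F] [DecidableEq F] {Γ : Type*} [LinearOrderedCommGroupWithZero Γ]
  {v : Valuation F Γ}

/-- The double of an integral point which reduces to a simple `2`-torsion point lies in the kernel
of reduction. -/
theorem inReductionKernel_two_nsmul {l x y : F} (hl : v l ≤ 1) (hx : v x ≤ 1)
    (h : (legendreCurve l).toAffine.Nonsingular x y) (hy : v y < 1) (hy2 : y ≠ -y)
    (hd : v (3 * x ^ 2 + 2 * (1 + l) * x + l) = 1) :
    InReductionKernel v (2 • Point.some x y h) := by
  have hne : y ≠ (legendreCurve l).toAffine.negY x y := by rwa [legendreCurve_negY]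
  rw [two_nsmul, Point.add_some (fun h => hne h.2)]
  have hyy : v (y - -y) < 1 := by rw [sub_neg_eq_add]; exact v.map_add_lt hy hy
  have hyy0 : y - -y ≠ 0 := sub_ne_zero.mpr hy2
  have hm := slope_of_Y_ne (W := legendreCurve l) (x₁ := x) rfl hne
  set m := (legendreCurve l).toAffine.slope x x y y
  rw [legendreCurve_negY] at hm
  -- The slope is a unit over `2 y`, hence not integral, and `x(2P)` is its square plus an integral
  -- term.
  have hvm : 1 < v m := by
    have e : m * (y - -y) = 3 * x ^ 2 + 2 * (1 + l) * x + l := by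
      rw [hm, div_mul_cancel₀ _ hyy0]; simp [legendreCurve]
    rw [← e, map_mul] at hd
    by_contra! hlt
    exact absurd hd (((mul_le_mul' hlt le_rfl).trans_eq (one_mul _)).trans_lt hyy).ne
  change 1 < v ((legendreCurve l).toAffine.addX x x m)
  have e : (legendreCurve l).toAffine.addX x x m = m ^ 2 + -((1 + l) + x + x) := by
    simp only [addX, legendreCurve]; ring
  have hvm2 : 1 < v (m ^ 2) := by rw [map_pow]; exact one_lt_pow₀ hvm two_ne_zero
  rw [e, v.map_add_eq_of_lt_left]
  · exact hvm2
  · rw [Valuation.map_neg]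
    exact (v.map_add_le (v.map_add_le (v.map_add_le (map_one v).le hl) hx) hx).trans_lt hvm2

end Doubling

/-! ### Primes of a number field. -/

section NumberField

open IsDedekindDomain

variable {L : Type*} [Field L] [NumberField L]

theorem valuation_natCast_eq_one (𝔭 : HeightOneSpectrum (𝓞 L)) {m : ℕ}
    (hm : ¬ ringChar (𝓞 L ⧸ 𝔭.asIdeal) ∣ m) : 𝔭.valuation L (m : L) = 1 := by
  have h : ((m : 𝓞 L)) ∉ 𝔭.asIdeal := fun h => hm <| by
    rw [← ringChar.spec, ← map_natCast (Ideal.Quotient.mk 𝔭.asIdeal)]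
    exact Ideal.Quotient.eq_zero_iff_mem.mpr h
  simpa using (𝔭.valuation_eq_one_iff_notMem (K := L)).mpr h

theorem ringChar_quotient_prime (𝔭 : HeightOneSpectrum (𝓞 L)) :
    (ringChar (𝓞 L ⧸ 𝔭.asIdeal)).Prime := by
  have := 𝔭.isPrime
  have : Finite (𝓞 L ⧸ 𝔭.asIdeal) := Ideal.finiteQuotientOfFreeOfNeBot _ 𝔭.ne_bot
  exact CharP.char_is_prime (𝓞 L ⧸ 𝔭.asIdeal) _

/-- With `l = u (u + 1) v² - u`, the derivative of the cubic at `u` is `u (u + 1)` plus a multiple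
of `v`, hence a unit at `𝔭`; so the doubling lemma applies. -/
theorem exists_addOrderOf_two_nsmul_dvd [DecidableEq L] (𝔭 : HeightOneSpectrum (𝓞 L))
    {n : ℕ} (hn : n ≠ 0) {u v : 𝓞 L} (hv2 : (u + 1) * v ^ 2 = u ^ (n - 1) + 1)
    (hv : v ∈ 𝔭.asIdeal) (hu : u ∉ 𝔭.asIdeal) (hu1 : u + 1 ∉ 𝔭.asIdeal) {x y l : L}
    (hx : x = u) (hy : y = u * (u + 1) * v) (hl : l = u ^ n) (hy0 : y ≠ 0)
    (hP : (legendreCurve l).toAffine.Nonsingular x y)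
    (hfin : IsOfFinAddOrder (Point.some x y hP)) :
    ∃ k, addOrderOf (2 • Point.some x y hP) ∣ ringChar (𝓞 L ⧸ 𝔭.asIdeal) ^ k := by
  have hy' : y = ((u * (u + 1) * v : 𝓞 L) : L) := by rw [hy]; push_cast; rfl
  have hl' : l = ((u ^ n : 𝓞 L) : L) := by rw [hl]; push_cast; rfl
  have vl : 𝔭.valuation L l ≤ 1 := by rw [hl']; exact 𝔭.valuation_le_one _
  have hy2 : y ≠ -y := by
    intro h
    have : (2 : L) * y = 0 := by linear_combination h
    exact (mul_ne_zero two_ne_zero hy0) this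
  refine InReductionKernel.addOrderOf_eq_prime_pow (v := 𝔭.valuation L) vl ?_ hfin.nsmul
    (ringChar_quotient_prime 𝔭) fun m => valuation_natCast_eq_one 𝔭
  refine inReductionKernel_two_nsmul vl ?_ hP ?_ hy2 ?_
  · rw [hx]; exact 𝔭.valuation_le_one _
  · rw [hy']
    exact (𝔭.valuation_lt_one_iff_mem _).mpr (𝔭.asIdeal.mul_mem_left _ hv)
  · have hd : 3 * x ^ 2 + 2 * (1 + l) * x + l =
        ((u * (u + 1) + (2 * u + 1) * (u * (u + 1) * v) * v : 𝓞 L) : L) := by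
      have e : u * (u + 1) + (2 * u + 1) * (u * (u + 1) * v) * v =
          3 * u ^ 2 + 2 * (1 + u ^ n) * u + u ^ n := by
        have hpow : u ^ n = u * u ^ (n - 1) := by rw [← pow_succ']; congr 1; omega
        rw [hpow]
        linear_combination (2 * u + 1) * u * hv2
      rw [e, hx, hl]; push_cast; rfl
    rw [hd, 𝔭.valuation_eq_one_iff_notMem]
    intro h
    have h1 := (𝔭.asIdeal.add_mem_iff_left (𝔭.asIdeal.mul_mem_left _ hv)).mp h
    exact (𝔭.isPrime.mem_or_mem h1).elim hu hu1

end NumberField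

/-- Since `u + λ = u (u + 1) v²`, the point reduces to the `2`-torsion point `(-λ, 0)` at both
primes, where the given model has good reduction by `u, u + 1 ∉ 𝔭 ∪ 𝔮`; so its double lies in both
kernels of reduction, whose torsion is of coprime orders. -/
theorem mainTheorem2
    {K L : Type*} [Field K] [NumberField K] [Field L] [NumberField L] [DecidableEq L] [Algebra K L]
    (l : 𝓞 K) (hE : (legendreCurve (l : K)).IsElliptic)
    (n : ℕ) (hn : 4 ≤ n) (hn_even : Even n)
    (u v : L) (hu : u ^ n = algebraMap K L (l : K))
    (hv : v ^ 2 = (u ^ (n - 1) + 1) / (u + 1)) (hv0 : v ≠ 0)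
    (hL : IntermediateField.adjoin K {u, v} = ⊤)
    (𝔭 𝔮 : IsDedekindDomain.HeightOneSpectrum (𝓞 L))
    (h2𝔭 : (2 : 𝓞 L) ∉ 𝔭.asIdeal) (h2𝔮 : (2 : 𝓞 L) ∉ 𝔮.asIdeal)
    (hchar : ringChar (𝓞 L ⧸ 𝔭.asIdeal) ≠ ringChar (𝓞 L ⧸ 𝔮.asIdeal))
    (hgood𝔭 : HasGoodReductionAt ((legendreCurve (l : K)).baseChange L) 𝔭)
    (hgood𝔮 : HasGoodReductionAt ((legendreCurve (l : K)).baseChange L) 𝔮)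
    (hv_mem : ∃ a : 𝓞 L, (a : L) = v ∧ a ∈ 𝔭.asIdeal ∧ a ∈ 𝔮.asIdeal)
    (hu_notMem : ∀ a : 𝓞 L, (a : L) = u → a ∉ 𝔭.asIdeal ∧ a ∉ 𝔮.asIdeal)
    (hu1_notMem : ∀ a : 𝓞 L, (a : L) = u + 1 → a ∉ 𝔭.asIdeal ∧ a ∉ 𝔮.asIdeal) :
    ∃ hP : ((legendreCurve (l : K)).baseChange L).toAffine.Nonsingular u (u * (u + 1) * v),
      ¬ IsOfFinAddOrder (WeierstrassCurve.Affine.Point.some u (u * (u + 1) * v) hP) := by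
  have hW : (legendreCurve (l : K)).baseChange L = legendreCurve (algebraMap K L (l : K)) := by
    simp [legendreCurve, WeierstrassCurve.baseChange, WeierstrassCurve.map]
  have hEL : ((legendreCurve (l : K)).baseChange L).IsElliptic :=
    inferInstanceAs ((legendreCurve (l : K)).map (algebraMap K L)).IsElliptic
  rw [hW] at hEL ⊢
  have hint : IsIntegral ℤ (algebraMap K L (l : K)) :=
    (NumberField.RingOfIntegers.isIntegral_coe l).map (algebraMap K L).toIntAlgHom
  rw [← hu] at hEL hint ⊢
  obtain ⟨hl0, hl1⟩ := (legendreCurve_isElliptic_iff two_ne_zero _).mp hEL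
  have hu0 : u ≠ 0 := by rintro rfl; exact hl0 (zero_pow (by omega))
  have hu1 : u + 1 ≠ 0 := fun h => hl1 <| by
    rw [eq_neg_of_add_eq_zero_left h, hn_even.neg_one_pow]
  have hy0 : u * (u + 1) * v ≠ 0 := mul_ne_zero (mul_ne_zero hu0 hu1) hv0
  rw [eq_div_iff hu1] at hv
  have hPeq : (legendreCurve (u ^ n)).toAffine.Equation u (u * (u + 1) * v) := by
    rw [legendreCurve_equation_iff]
    have hpow : u ^ n = u * u ^ (n - 1) := by rw [← pow_succ']; congr 1; omega
    rw [hpow]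
    linear_combination u ^ 2 * (u + 1) * hv
  have hP := equation_iff_nonsingular.mp hPeq
  refine ⟨hP, fun hfin => ?_⟩
  obtain ⟨b, hb, hb𝔭, hb𝔮⟩ := hv_mem
  -- `u` is integral because `u ^ n = λ` is; the non-membership hypotheses, which range over
  -- integral lifts of `u` and `u + 1`, say nothing without such a lift.
  obtain ⟨a, ha⟩ : ∃ a : 𝓞 L, (a : L) = u := ⟨⟨u, hint.of_pow (by omega)⟩, rfl⟩
  have ha1 : ((a + 1 : 𝓞 L) : L) = u + 1 := by rw [← ha]; push_cast; rfl
  have hab : (a + 1) * b ^ 2 = a ^ (n - 1) + 1 := by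
    have h : ((a : L) + 1) * (b : L) ^ 2 = (a : L) ^ (n - 1) + 1 := by
      rw [ha, hb, ← hv]; ring
    apply NumberField.RingOfIntegers.ext
    push_cast
    exact h
  have hy : u * (u + 1) * v = (a : L) * (a + 1) * b := by rw [ha, hb]
  have hl : u ^ n = (a : L) ^ n := by rw [ha]
  obtain ⟨i, hi⟩ := exists_addOrderOf_two_nsmul_dvd 𝔭 (by omega) hab hb𝔭 (hu_notMem a ha).1
    (hu1_notMem _ ha1).1 ha.symm hy hl hy0 hP hfin
  obtain ⟨j, hj⟩ := exists_addOrderOf_two_nsmul_dvd 𝔮 (by omega) hab hb𝔮 (hu_notMem a ha).2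
    (hu1_notMem _ ha1).2 ha.symm hy hl hy0 hP hfin
  have hcop := Nat.Coprime.pow i j
    ((Nat.coprime_primes (ringChar_quotient_prime 𝔭) (ringChar_quotient_prime 𝔮)).mpr hchar)
  have hone := AddMonoid.addOrderOf_eq_one_iff.mp (Nat.eq_one_of_dvd_coprimes hcop hi hj)
  -- Since `y ≠ 0` in characteristic zero, `P ≠ -P`, so `2P` is an affine point and cannot be 0.
  have hne : ¬(u = u ∧ u * (u + 1) * v =
      (legendreCurve (u ^ n)).toAffine.negY u (u * (u + 1) * v)) := by
    rintro ⟨-, h⟩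
    rw [legendreCurve_negY] at h
    have : (2 : L) * (u * (u + 1) * v) = 0 := by linear_combination h
    exact (mul_ne_zero two_ne_zero hy0) this
  rw [two_nsmul, Point.add_some hne] at hone
  exact Point.some_ne_zero _ hone
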